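/- **Setting.** Let $L$ be a *local language*: a many-sorted first-order language with relation symbols and constant symbols but no other function symbols, together with (a) for each single sort $s$ a partially ordered monoid $(\mathtt D^s,\mathrm d^0,*,\preceq)$ of binary relation symbols on $s$ (the *locality relations* on $s$), whose identity $\mathrm d^0$ is the equality symbol and is also the least element, and (b) a function assigning to any two constants $c_1,c_2$ of a common sort a locality relation $\mathrm B_{c_1,c_2}$ on that sort. Structures are $L$-structures with all sorts non-empty. A *local structure* is an $L$-structure $M$ such that locality relations are symmetric; $\mathrm d_1\preceq\mathrm d_2$ implies $\mathrm d_1^M\subseteq \mathrm d_2^M$; $\mathrm d_1^M\circ \mathrm d_2^M\subseteq(\mathrm d_1*\mathrm d_2)^M$; $M\models\mathrm B_{c_1,c_2}(c_1,c_2)$ for all constants $c_1,c_2$ of a common sort; and any two elements of the same sort are related by some locality relation. *Positive* formulas are built from atomic formulas by $\wedge,\vee,\exists$; *local positive* formulas are built from atomic formulas by $\wedge$, $\vee$ and local quantification $\exists y\,(\mathrm d(y,t)\wedge\varphi)$, with $\mathrm d$ a locality relation and $t$ a term (a constant or a variable) other than $y$; *negative* formulas are negations of positive ones. A *local model* of a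 set $\Gamma$ of sentences is a local structure satisfying $\Gamma$, and $\Gamma$ is *locally satisfiable* if it has one. A *negative local theory* is a set of negative sentences that contains every negative sentence true in all its local models. $\mathrm{Th}_-(M)$ is the set of negative sentences true in $M$. A homomorphism $f:A\to B$ is a *positive embedding* if $B\models\varphi(f(a))$ implies $A\models\varphi(a)$ for all positive $\varphi(x)$ and $a\in A^x$. Fix a locally satisfiable negative local theory $T$ of $L$, and let $M$ be a local structure. - If $M\models T$, then $M$ is *$\kappa$-ultrahomogeneous* for $T$ if, for all structures $A,B$ with $|A|,|B|<\kappa$ and $B$ a local model of $T$, every positive embedding $f:A\to M$ and every homomorphism $g:A\to B$, there is a homomorphism $h:B\to M$ with $h\circ g=f$. It is *absolutely ultrahomogeneous* if this holds for every cardinal $\kappa$. - $M$ is a *local positively closed* model of $T$ if $M\models T$ and every homomorphism from $M$ to a local model of $T$ is a positive embedding. - For a tuple $x$ of variables (possibly infinite), a *partial local positive type* on $x$ of a set of sentences $\Gamma$ is a set of local positive formulas in $x$ realised by a single tuple in some local model of $\Gamma$; a *local positive type* is a maximal one. $\Gamma$ has the *local joint property* if any two local models of $\Gamma$ admit homomorphisms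 to a common local model of $\Gamma$. - For a subset $A$ of $M$, $L(A)$ is $L$ with constants added for the elements of $A$, with a bound function extending that of $L$ and chosen so that the natural expansion $M_A$ is a local $L(A)$-structure, and $\mathrm{Th}_-(M/A)=\mathrm{Th}_-(M_A)$. $M$ is *$\kappa$-saturated* if, for every such $A$ with $|A|<\kappa$ (and every such choice of bounds) for which $\mathrm{Th}_-(M/A)$ has the local joint property, and for every $x$ with $|x|<\kappa$, every local positive type of $\mathrm{Th}_-(M/A)$ on $x$ is realised in $M_A$. It is *absolutely saturated* if this holds for every cardinal $\kappa$. **Theorem.** Let $R$ be a local model of $T$. The following are equivalent. (i) $R$ is an absolutely ultrahomogeneous model of $T$. (ii) $R$ is a *retractor* of $T$: for every homomorphism $f:R\to N$ to a local model $N$ of $T$ there is a homomorphism $g:N\to R$ with $g\circ f=\mathrm{id}_R$. (iii) $R$ is an absolutely saturated, local positively closed model of $T$. -/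

import Mathlib

universe u

namespace LocalPositive

/-- A (many-sorted) local first-order language: no function symbols other than constants, and for
every single sort `s` an ordered monoid `Loc s` of binary relation symbols (the locality relation
symbols on `s`). The identity `1 : Loc s` is the equality symbol of sort `s` and the least element.
`Rel w` is the set of the remaining relation symbols whose sort is the tuple `w`. -/
structure LocalLanguage : Type (u + 1) where
  Sorts : Type u
  Const : Sorts → Type u
  Rel : List Sorts → Type u
  Loc : Sorts → Type u
  [locMonoid : ∀ s, Monoid (Loc s)]
  [locOrder : ∀ s, PartialOrder (Loc s)]
  mul_le_mul : ∀ (s : Sorts) (d₁ d₂ e₁ e₂ : Loc s), d₁ ≤ d₂ → e₁ ≤ e₂ → d₁ * e₁ ≤ d₂ * e₂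
  one_le : ∀ (s : Sorts) (d : Loc s), 1 ≤ d
  bound : ∀ {s : Sorts}, Const s → Const s → Loc s

attribute [instance] LocalLanguage.locMonoid LocalLanguage.locOrder

/-! ### First-order formulas -/

/-- Terms of sort `s`, with free variables from a (possibly infinite) variable `x`, given as a
family of single variables indexed by `I` with their sorts, and with bound (de Bruijn) variables
whose sorts are listed in `Δ`. -/
inductive Term (L : LocalLanguage.{u}) {I : Type u} (x : I → L.Sorts) (Δ : List L.Sorts) :
    L.Sorts → Type u
  | var (i : I) : Term L x Δ (x i)
  | bvar (k : Fin Δ.length) : Term L x Δ (Δ.get k)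
  | const {s : L.Sorts} (c : L.Const s) : Term L x Δ s

/-- The same term, regarded as a term in one more bound variable, which it does not mention. -/
def Term.weaken {L : LocalLanguage.{u}} {I : Type u} {x : I → L.Sorts} {Δ : List L.Sorts}
    (s' : L.Sorts) : {s : L.Sorts} → Term L x Δ s → Term L x (s' :: Δ) s
  | _, .var i => .var i
  | _, .bvar k => .bvar (Δ := s' :: Δ) k.succ
  | _, .const c => .const c

/-- First-order formulas. The atomic formulas are `loc d t₁ t₂`, where `d = 1` is equality, and
`rel R ts`. In `ex s φ` the newly bound variable is the bound variable `0` of `φ`. -/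
inductive Formula (L : LocalLanguage.{u}) {I : Type u} (x : I → L.Sorts) :
    List L.Sorts → Type u
  | loc {Δ : List L.Sorts} {s : L.Sorts} (d : L.Loc s) (t₁ t₂ : Term L x Δ s) : Formula L x Δ
  | rel {Δ : List L.Sorts} {w : List L.Sorts} (R : L.Rel w)
      (ts : ∀ k : Fin w.length, Term L x Δ (w.get k)) : Formula L x Δ
  | neg {Δ : List L.Sorts} (φ : Formula L x Δ) : Formula L x Δ
  | and {Δ : List L.Sorts} (φ ψ : Formula L x Δ) : Formula L x Δ
  | or {Δ : List L.Sorts} (φ ψ : Formula L x Δ) : Formula L x Δ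
  | ex {Δ : List L.Sorts} (s : L.Sorts) (φ : Formula L x (s :: Δ)) : Formula L x Δ

/-- The local existential quantification of `φ` in `d(t)`. -/
def Formula.localEx {L : LocalLanguage.{u}} {I : Type u} {x : I → L.Sorts} {Δ : List L.Sorts}
    {s : L.Sorts} (d : L.Loc s) (t : Term L x Δ s) (φ : Formula L x (s :: Δ)) : Formula L x Δ :=
  .ex s (.and (.loc d (.bvar (Δ := s :: Δ) (0 : Fin (Δ.length + 1))) (t.weaken s)) φ)

/-- Positive formulas. -/
inductive Formula.IsPositive {L : LocalLanguage.{u}} {I : Type u} {x : I → L.Sorts} :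
    {Δ : List L.Sorts} → Formula L x Δ → Prop
  | loc {Δ : List L.Sorts} {s : L.Sorts} (d : L.Loc s) (t₁ t₂ : Term L x Δ s) :
      IsPositive (.loc d t₁ t₂)
  | rel {Δ : List L.Sorts} {w : List L.Sorts} (R : L.Rel w)
      (ts : ∀ k : Fin w.length, Term L x Δ (w.get k)) : IsPositive (.rel R ts)
  | and {Δ : List L.Sorts} {φ ψ : Formula L x Δ} :
      IsPositive φ → IsPositive ψ → IsPositive (.and φ ψ)
  | or {Δ : List L.Sorts} {φ ψ : Formula L x Δ} :
      IsPositive φ → IsPositive ψ → IsPositive (.or φ ψ)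
  | ex {Δ : List L.Sorts} {s : L.Sorts} {φ : Formula L x (s :: Δ)} :
      IsPositive φ → IsPositive (.ex s φ)

/-- Local positive formulas. -/
inductive Formula.IsLocalPositive {L : LocalLanguage.{u}} {I : Type u} {x : I → L.Sorts} :
    {Δ : List L.Sorts} → Formula L x Δ → Prop
  | loc {Δ : List L.Sorts} {s : L.Sorts} (d : L.Loc s) (t₁ t₂ : Term L x Δ s) :
      IsLocalPositive (.loc d t₁ t₂)
  | rel {Δ : List L.Sorts} {w : List L.Sorts} (R : L.Rel w)
      (ts : ∀ k : Fin w.length, Term L x Δ (w.get k)) : IsLocalPositive (.rel R ts)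
  | and {Δ : List L.Sorts} {φ ψ : Formula L x Δ} :
      IsLocalPositive φ → IsLocalPositive ψ → IsLocalPositive (.and φ ψ)
  | or {Δ : List L.Sorts} {φ ψ : Formula L x Δ} :
      IsLocalPositive φ → IsLocalPositive ψ → IsLocalPositive (.or φ ψ)
  | localEx {Δ : List L.Sorts} {s : L.Sorts} (d : L.Loc s) (t : Term L x Δ s)
      {φ : Formula L x (s :: Δ)} : IsLocalPositive φ → IsLocalPositive (.localEx d t φ)

/-- Negative formulas: negations of positive formulas. -/
def Formula.IsNegative {L : LocalLanguage.{u}} {I : Type u} {x : I → L.Sorts} {Δ : List L.Sorts}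
    (φ : Formula L x Δ) : Prop :=
  ∃ ψ : Formula L x Δ, ψ.IsPositive ∧ φ = .neg ψ

/-- Sentences: formulas without free variables. -/
abbrev Sentence (L : LocalLanguage.{u}) : Type u :=
  Formula L (fun i : PEmpty.{u + 1} => (i.elim : L.Sorts)) []

/-! ### Structures -/

/-- Arbitrary (not necessarily local) structures; every sort is non-empty, and the equality symbol
is interpreted as equality. -/
structure LStructure (L : LocalLanguage.{u}) : Type (u + 1) where
  carrier : L.Sorts → Type u
  nonempty : ∀ s, Nonempty (carrier s)
  const : ∀ {s : L.Sorts}, L.Const s → carrier s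
  rel : ∀ {w : List L.Sorts}, L.Rel w → (∀ k : Fin w.length, carrier (w.get k)) → Prop
  loc : ∀ {s : L.Sorts}, L.Loc s → carrier s → carrier s → Prop
  loc_one : ∀ {s : L.Sorts} (a b : carrier s), loc 1 a b ↔ a = b

/-- The cardinality of a structure: the total number of single elements. -/
def LStructure.card {L : LocalLanguage.{u}} (M : LStructure L) : Cardinal.{u} :=
  Cardinal.mk (Σ s, M.carrier s)

/-- The set `M ^ x` of tuples of `M` of the sort of `x`. -/
abbrev LStructure.Tuple {L : LocalLanguage.{u}} (M : LStructure L) {I : Type u}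
    (x : I → L.Sorts) : Type u :=
  ∀ i, M.carrier (x i)

/-- Value of a term. -/
def Term.eval {L : LocalLanguage.{u}} (M : LStructure L) {I : Type u} {x : I → L.Sorts}
    {Δ : List L.Sorts} (v : M.Tuple x) (w : ∀ k : Fin Δ.length, M.carrier (Δ.get k)) :
    {s : L.Sorts} → Term L x Δ s → M.carrier s
  | _, .var i => v i
  | _, .bvar k => w k
  | _, .const c => M.const c

/-- Extends an assignment of the bound variables by a value for the new bound variable `0`. -/
def LStructure.push {L : LocalLanguage.{u}} (M : LStructure L) {Δ : List L.Sorts} {s : L.Sorts}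
    (a : M.carrier s) (w : ∀ k : Fin Δ.length, M.carrier (Δ.get k)) :
    ∀ k : Fin (s :: Δ).length, M.carrier ((s :: Δ).get k) :=
  Fin.cons (n := Δ.length) (α := fun k => M.carrier ((s :: Δ).get k)) a w

/-- Truth of a formula in a structure under an assignment. -/
def Formula.Realize {L : LocalLanguage.{u}} (M : LStructure L) {I : Type u} {x : I → L.Sorts}
    (v : M.Tuple x) :
    {Δ : List L.Sorts} → Formula L x Δ → (∀ k : Fin Δ.length, M.carrier (Δ.get k)) → Prop
  | _, .loc d t₁ t₂, w => M.loc d (t₁.eval M v w) (t₂.eval M v w)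
  | _, .rel R ts, w => M.rel R (fun k => (ts k).eval M v w)
  | _, .neg φ, w => ¬ φ.Realize M v w
  | _, .and φ ψ, w => φ.Realize M v w ∧ ψ.Realize M v w
  | _, .or φ ψ, w => φ.Realize M v w ∨ ψ.Realize M v w
  | _, .ex s φ, w => ∃ a : M.carrier s, φ.Realize M v (M.push a w)

/-- `M ⊨ φ(a)` for a formula `φ(x)` and `a ∈ M ^ x`. -/
def LStructure.Sat {L : LocalLanguage.{u}} (M : LStructure L) {I : Type u} {x : I → L.Sorts}
    (φ : Formula L x []) (a : M.Tuple x) : Prop :=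
  φ.Realize M a (fun k => k.elim0)

/-- `M ⊨ φ` for a sentence `φ`. -/
def LStructure.Models {L : LocalLanguage.{u}} (M : LStructure L) (φ : Sentence L) : Prop :=
  M.Sat φ (fun i => i.elim)

/-- Local structures: the five locality axioms. -/
structure LStructure.IsLocal {L : LocalLanguage.{u}} (M : LStructure L) : Prop where
  symm : ∀ {s : L.Sorts} (d : L.Loc s) (a b : M.carrier s), M.loc d a b → M.loc d b a
  mono : ∀ {s : L.Sorts} (d₁ d₂ : L.Loc s), d₁ ≤ d₂ →
    ∀ a b : M.carrier s, M.loc d₁ a b → M.loc d₂ a b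
  comp : ∀ {s : L.Sorts} (d₁ d₂ : L.Loc s) (a b c : M.carrier s),
    M.loc d₁ a b → M.loc d₂ b c → M.loc (d₁ * d₂) a c
  bound : ∀ {s : L.Sorts} (c₁ c₂ : L.Const s), M.loc (L.bound c₁ c₂) (M.const c₁) (M.const c₂)
  total : ∀ {s : L.Sorts} (a b : M.carrier s), ∃ d : L.Loc s, M.loc d a b

/-- `M` is a local model of the set of sentences `T`. -/
def LStructure.IsLocalModel {L : LocalLanguage.{u}} (M : LStructure L) (T : Set (Sentence L)) :
    Prop :=
  M.IsLocal ∧ ∀ φ ∈ T, M.Models φ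

/-- `T` has a local model. -/
def LocallySatisfiable {L : LocalLanguage.{u}} (T : Set (Sentence L)) : Prop :=
  ∃ M : LStructure L, M.IsLocalModel T

/-- Negative local theories: sets of negative sentences closed under local implication. -/
def IsNegativeLocalTheory {L : LocalLanguage.{u}} (T : Set (Sentence L)) : Prop :=
  (∀ φ ∈ T, φ.IsNegative) ∧
    ∀ φ : Sentence L, φ.IsNegative → (∀ M : LStructure L, M.IsLocalModel T → M.Models φ) → φ ∈ T

/-- The negative theory of a structure. -/
def LStructure.negTheory {L : LocalLanguage.{u}} (M : LStructure L) : Set (Sentence L) :=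
  {φ | φ.IsNegative ∧ M.Models φ}

/-! ### Homomorphisms -/

/-- Homomorphisms of structures. -/
structure Hom {L : LocalLanguage.{u}} (M N : LStructure L) : Type u where
  toFun : ∀ {s : L.Sorts}, M.carrier s → N.carrier s
  map_const : ∀ {s : L.Sorts} (c : L.Const s), toFun (M.const c) = N.const c
  map_rel : ∀ {w : List L.Sorts} (R : L.Rel w) (a : ∀ k : Fin w.length, M.carrier (w.get k)),
    M.rel R a → N.rel R (fun k => toFun (a k))
  map_loc : ∀ {s : L.Sorts} (d : L.Loc s) (a b : M.carrier s),
    M.loc d a b → N.loc d (toFun a) (toFun b)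

/-- Positive embeddings: homomorphisms reflecting the truth of positive formulas. -/
def Hom.IsPositiveEmbedding {L : LocalLanguage.{u}} {M N : LStructure L} (f : Hom M N) : Prop :=
  ∀ (I : Type u) (x : I → L.Sorts) (φ : Formula L x []) (a : M.Tuple x),
    φ.IsPositive → N.Sat φ (fun i => f.toFun (a i)) → M.Sat φ a

/-- `M` is a local positively closed model of `T`. -/
def LStructure.IsLocalPosClosed {L : LocalLanguage.{u}} (M : LStructure L)
    (T : Set (Sentence L)) : Prop :=
  M.IsLocalModel T ∧
    ∀ N : LStructure L, N.IsLocalModel T → ∀ f : Hom M N, f.IsPositiveEmbedding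

/-- The local joint (homomorphism) property. -/
def LocalJointProperty {L : LocalLanguage.{u}} (T : Set (Sentence L)) : Prop :=
  ∀ A B : LStructure L, A.IsLocalModel T → B.IsLocalModel T →
    ∃ M : LStructure L, M.IsLocalModel T ∧ Nonempty (Hom A M) ∧ Nonempty (Hom B M)

/-! ### Local positive types -/

/-- `Γ` is a partial local positive type of `T` on the variable `x`. -/
def IsPartialLocalPosType {L : LocalLanguage.{u}} (T : Set (Sentence L)) {I : Type u}
    (x : I → L.Sorts) (Γ : Set (Formula L x [])) : Prop :=
  (∀ φ ∈ Γ, φ.IsLocalPositive) ∧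
    ∃ M : LStructure L, M.IsLocalModel T ∧ ∃ a : M.Tuple x, ∀ φ ∈ Γ, M.Sat φ a

/-- `p` is a local positive type of `T` on `x`: a maximal partial local positive type. -/
def IsLocalPosType {L : LocalLanguage.{u}} (T : Set (Sentence L)) {I : Type u}
    (x : I → L.Sorts) (p : Set (Formula L x [])) : Prop :=
  Maximal (IsPartialLocalPosType T x) p

/-! ### Parameters -/

/-- The interpretation in `M` of the constants of `L(A)`. -/
def LStructure.paramConst {L : LocalLanguage.{u}} (M : LStructure L)
    (A : ∀ s, Set (M.carrier s)) {s : L.Sorts} : L.Const s ⊕ A s → M.carrier s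
  | .inl c => M.const c
  | .inr a => a

/-- A bound function for `L(A)`: it extends the bound function of `L` and makes the natural
expansion of `M` to `L(A)` satisfy the locality axiom on bounds. -/
structure LStructure.ParamBound {L : LocalLanguage.{u}} (M : LStructure L)
    (A : ∀ s, Set (M.carrier s)) : Type u where
  bound : ∀ {s : L.Sorts}, L.Const s ⊕ A s → L.Const s ⊕ A s → L.Loc s
  extends_bound : ∀ {s : L.Sorts} (c₁ c₂ : L.Const s),
    bound (.inl c₁) (.inl c₂) = L.bound c₁ c₂
  holds : ∀ {s : L.Sorts} (c₁ c₂ : L.Const s ⊕ A s),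
    M.loc (bound c₁ c₂) (M.paramConst A c₁) (M.paramConst A c₂)

/-- The local language `L(A)`: `L` with new constants for the elements of `A`. -/
abbrev LStructure.paramLanguage {L : LocalLanguage.{u}} (M : LStructure L)
    (A : ∀ s, Set (M.carrier s)) (β : M.ParamBound A) : LocalLanguage.{u} where
  Sorts := L.Sorts
  Const s := L.Const s ⊕ A s
  Rel := L.Rel
  Loc := L.Loc
  mul_le_mul := L.mul_le_mul
  one_le := L.one_le
  bound := β.bound

/-- The natural expansion `M_A` of `M` to `L(A)`. -/
abbrev LStructure.paramExpansion {L : LocalLanguage.{u}} (M : LStructure L)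
    (A : ∀ s, Set (M.carrier s)) (β : M.ParamBound A) : LStructure (M.paramLanguage A β) where
  carrier := M.carrier
  nonempty := M.nonempty
  const := M.paramConst A
  rel := M.rel
  loc := M.loc
  loc_one := M.loc_one

/-- `Th₋(M/A)`. -/
def LStructure.negTheoryOver {L : LocalLanguage.{u}} (M : LStructure L)
    (A : ∀ s, Set (M.carrier s)) (β : M.ParamBound A) : Set (Sentence (M.paramLanguage A β)) :=
  (M.paramExpansion A β).negTheory

/-! ### Ultrahomogeneity, retractors and saturation -/

/-- `M` is a local positively `κ`-ultrahomogeneous model of `T`. -/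
def LStructure.IsUltrahomogeneous {L : LocalLanguage.{u}} (M : LStructure L)
    (T : Set (Sentence L)) (κ : Cardinal.{u}) : Prop :=
  M.IsLocalModel T ∧
    ∀ (A B : LStructure L), B.IsLocalModel T → A.card < κ → B.card < κ →
      ∀ (f : Hom A M) (g : Hom A B), f.IsPositiveEmbedding →
        ∃ h : Hom B M, ∀ (s : L.Sorts) (a : A.carrier s), h.toFun (g.toFun a) = f.toFun a

/-- `M` is a local positively absolutely ultrahomogeneous model of `T`. -/
def LStructure.IsAbsolutelyUltrahomogeneous {L : LocalLanguage.{u}} (M : LStructure L)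
    (T : Set (Sentence L)) : Prop :=
  ∀ κ : Cardinal.{u}, M.IsUltrahomogeneous T κ

/-- `g` is a retraction of `f`. -/
def Hom.IsRetraction {L : LocalLanguage.{u}} {A B : LStructure L} (f : Hom A B) (g : Hom B A) :
    Prop :=
  ∀ (s : L.Sorts) (a : A.carrier s), g.toFun (f.toFun a) = a

/-- `M` is a retractor of `T`. -/
def LStructure.IsRetractor {L : LocalLanguage.{u}} (M : LStructure L) (T : Set (Sentence L)) :
    Prop :=
  M.IsLocalModel T ∧
    ∀ N : LStructure L, N.IsLocalModel T → ∀ f : Hom M N, ∃ g : Hom N M, f.IsRetraction g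

/-- `M` is local positively `κ`-saturated: a local structure that realises every local positive
type on `x` over `A` if `|x| < κ`, `|A| < κ` and `M` has the local joint property over `A`. -/
def LStructure.IsLocalPosSaturated {L : LocalLanguage.{u}} (M : LStructure L)
    (κ : Cardinal.{u}) : Prop :=
  M.IsLocal ∧
    ∀ (A : ∀ s, Set (M.carrier s)) (β : M.ParamBound A),
      Cardinal.mk (Σ s, A s) < κ → LocalJointProperty (M.negTheoryOver A β) →
      ∀ (I : Type u) (x : I → L.Sorts), Cardinal.mk I < κ →
        ∀ p : Set (Formula (M.paramLanguage A β) x []),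
          IsLocalPosType (M.negTheoryOver A β) x p →
            ∃ a : (M.paramExpansion A β).Tuple x, ∀ φ ∈ p, (M.paramExpansion A β).Sat φ a

/-- `M` is local positively absolutely saturated. -/
def LStructure.IsAbsolutelySaturated {L : LocalLanguage.{u}} (M : LStructure L) : Prop :=
  ∀ κ : Cardinal.{u}, M.IsLocalPosSaturated κ

end LocalPositive

open LocalPositive

/-!
Ultrahomogeneity gives retractions at once: apply it to `A = R`, `f = id` and a homomorphism
`g : R → N`. Retractions reflect positive formulas, so a retractor is local positively closed. It
is saturated because, under the local joint property of `Th₋(R/A)`, a realisation of a local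
positive type over `A` is found in a local model of `Th₋(R/A)` that extends `R`, and a retraction to `R`
fixes `A` and preserves positive formulas.

The remaining two implications rest on the local ultrapower `LStructure.localPower` of a local
structure `B`: the part of `B ^ J / U` at bounded distance from the diagonal image of `B`. Positive
formulas descend from it to `B`, and local positive formulas lift to it
(`LStructure.eventually_realize_of_localPower`, `LStructure.IsLocal.realize_localPower`). In
particular the diagonal is a positive embedding and negative sentences are preserved. Taking for `J`
the set of tuples of `B` of a given sort yields compactness for conditions that bound all variables.

The first consequence is amalgamation (`exists_amalgam`): if the positive formulas true of a tuple
in `R` are true of a tuple in `B`, and every sort contains a term in these tuples, then `R` and `B`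
map to a common local structure in which the tuples coincide and `B` embeds positively. With a
retraction of the amalgam to `R` this proves ultrahomogeneity. Used twice, it also shows that
`Th₋(R/R)` has the local joint property.

The second consequence is that over a set of constants that meets all sorts, the local positive
formulas true of a tuple extend to a maximal type (`LStructure.IsLocal.exists_isLocalPosType`). If
`R` is local positively closed and `f : R → N`, then `N` is a local model of `Th₋(R/R)`, so the
formulas true in `N` of an enumeration of `N` extend to a local positive type over `R`. A
realisation of it in `R` is a retraction of `f`.
-/

namespace LocalPositive

variable {L : LocalLanguage.{u}}

/-! ### Substitution in formulas -/

section Substitution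

variable {I I' : Type u} {x : I → L.Sorts} {y : I' → L.Sorts}

theorem Term.eval_weaken (M : LStructure L) (v : M.Tuple x) {Δ : List L.Sorts}
    (w : ∀ k : Fin Δ.length, M.carrier (Δ.get k)) {s' : L.Sorts} (a : M.carrier s')
    {s : L.Sorts} (t : Term L x Δ s) :
    (t.weaken s').eval M v (M.push a w) = t.eval M v w := by
  cases t <;> rfl

/-- Simultaneous substitution of terms for the free variables (by `σ`) and for the bound variables
(by `τ`) of a term. -/
def Term.subst {Δ Δ' : List L.Sorts} (σ : ∀ i, Term L y Δ' (x i))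
    (τ : ∀ k : Fin Δ.length, Term L y Δ' (Δ.get k)) :
    {s : L.Sorts} → Term L x Δ s → Term L y Δ' s
  | _, .var i => σ i
  | _, .bvar k => τ k
  | _, .const c => .const c

/-- A substitution for bound variables, carried under one more quantifier. -/
def Term.liftSubst {Δ Δ' : List L.Sorts} (s : L.Sorts)
    (τ : ∀ k : Fin Δ.length, Term L y Δ' (Δ.get k)) :
    ∀ k : Fin (s :: Δ).length, Term L y (s :: Δ') ((s :: Δ).get k) :=
  Fin.cons (n := Δ.length) (α := fun k => Term L y (s :: Δ') ((s :: Δ).get k))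
    (.bvar (Δ := s :: Δ') (0 : Fin (Δ'.length + 1))) (fun k => (τ k).weaken s)

/-- Simultaneous substitution of terms for the free variables (by `σ`) and for the bound variables
(by `τ`) of a formula. -/
def Formula.subst : {Δ : List L.Sorts} → Formula L x Δ → {Δ' : List L.Sorts} →
    (∀ i, Term L y Δ' (x i)) → (∀ k : Fin Δ.length, Term L y Δ' (Δ.get k)) → Formula L y Δ'
  | _, .loc d t₁ t₂, _, σ, τ => .loc d (t₁.subst σ τ) (t₂.subst σ τ)
  | _, .rel R ts, _, σ, τ => .rel R (fun k => (ts k).subst σ τ)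
  | _, .neg φ, _, σ, τ => .neg (φ.subst σ τ)
  | _, .and φ ψ, _, σ, τ => .and (φ.subst σ τ) (ψ.subst σ τ)
  | _, .or φ ψ, _, σ, τ => .or (φ.subst σ τ) (ψ.subst σ τ)
  | _, .ex s φ, _, σ, τ => .ex s (φ.subst (fun i => (σ i).weaken s) (Term.liftSubst s τ))

theorem Term.eval_subst (M : LStructure L) {Δ Δ' : List L.Sorts}
    (σ : ∀ i, Term L y Δ' (x i)) (τ : ∀ k : Fin Δ.length, Term L y Δ' (Δ.get k))
    (v : M.Tuple y) (w : ∀ k : Fin Δ'.length, M.carrier (Δ'.get k)) {s : L.Sorts}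
    (t : Term L x Δ s) :
    (t.subst σ τ).eval M v w =
      t.eval M (fun i => (σ i).eval M v w) (fun k => (τ k).eval M v w) := by
  cases t <;> rfl

theorem Formula.realize_subst (M : LStructure L) {Δ : List L.Sorts} (φ : Formula L x Δ)
    {Δ' : List L.Sorts} (σ : ∀ i, Term L y Δ' (x i))
    (τ : ∀ k : Fin Δ.length, Term L y Δ' (Δ.get k))
    (v : M.Tuple y) (w : ∀ k : Fin Δ'.length, M.carrier (Δ'.get k)) :
    (φ.subst σ τ).Realize M v w ↔
      φ.Realize M (fun i => (σ i).eval M v w) (fun k => (τ k).eval M v w) := by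
  induction φ generalizing Δ' with
  | loc d t₁ t₂ => simp only [subst, Realize, Term.eval_subst]
  | rel R ts => simp only [subst, Realize, Term.eval_subst]
  | neg φ ih => simp only [subst, Realize, ih]
  | and φ ψ ih₁ ih₂ => simp only [subst, Realize, ih₁, ih₂]
  | or φ ψ ih₁ ih₂ => simp only [subst, Realize, ih₁, ih₂]
  | ex s φ ih =>
    simp only [subst, Realize]
    refine exists_congr fun a => ?_
    rw [ih]
    simp only [Term.eval_weaken]
    refine iff_of_eq (congrArg (Formula.Realize M _ φ) (funext fun k => ?_))
    refine Fin.cases ?_ (fun k => ?_) k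
    · rfl
    · exact Term.eval_weaken M v w a (τ k)

theorem Formula.IsPositive.subst {Δ : List L.Sorts} {φ : Formula L x Δ} (h : φ.IsPositive)
    {Δ' : List L.Sorts} (σ : ∀ i, Term L y Δ' (x i))
    (τ : ∀ k : Fin Δ.length, Term L y Δ' (Δ.get k)) : (φ.subst σ τ).IsPositive := by
  induction h generalizing Δ' with
  | loc d t₁ t₂ => exact .loc _ _ _
  | rel R ts => exact .rel _ _
  | and _ _ ih₁ ih₂ => exact .and (ih₁ _ _) (ih₂ _ _)
  | or _ _ ih₁ ih₂ => exact .or (ih₁ _ _) (ih₂ _ _)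
  | ex _ ih => exact .ex (ih _ _)

theorem Formula.IsLocalPositive.isPositive {Δ : List L.Sorts} {φ : Formula L x Δ}
    (h : φ.IsLocalPositive) : φ.IsPositive := by
  induction h with
  | loc d t₁ t₂ => exact .loc _ _ _
  | rel R ts => exact .rel _ _
  | and _ _ ih₁ ih₂ => exact .and ih₁ ih₂
  | or _ _ ih₁ ih₂ => exact .or ih₁ ih₂
  | localEx d t _ ih => exact .ex (.and (.loc _ _ _) ih)

end Substitution

/-! ### Existential closures of positive formulas -/

section ExistentialClosure

variable {I I' : Type u} {x : I → L.Sorts} {y : I' → L.Sorts}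

theorem Term.exists_support {Δ : List L.Sorts} {s : L.Sorts} (t : Term L x Δ s) :
    ∃ S : Finset I, ∀ (M : LStructure L) (v v' : M.Tuple x), (∀ i ∈ S, v i = v' i) →
      ∀ w, t.eval M v w = t.eval M v' w := by
  cases t with
  | var i => exact ⟨{i}, fun M v v' h w => h i (Finset.mem_singleton_self i)⟩
  | bvar k => exact ⟨∅, fun _ _ _ _ _ => rfl⟩
  | const c => exact ⟨∅, fun _ _ _ _ _ => rfl⟩

/-- The truth of a formula depends on the values of finitely many free variables only. -/
theorem Formula.exists_support {Δ : List L.Sorts} (φ : Formula L x Δ) :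
    ∃ S : Finset I, ∀ (M : LStructure L) (v v' : M.Tuple x), (∀ i ∈ S, v i = v' i) →
      ∀ w, φ.Realize M v w ↔ φ.Realize M v' w := by
  classical
  induction φ with
  | loc d t₁ t₂ =>
    obtain ⟨S₁, h₁⟩ := t₁.exists_support
    obtain ⟨S₂, h₂⟩ := t₂.exists_support
    refine ⟨S₁ ∪ S₂, fun M v v' h w => ?_⟩
    simp only [Realize]
    rw [h₁ M v v' (fun i hi => h i (Finset.mem_union_left _ hi)),
      h₂ M v v' (fun i hi => h i (Finset.mem_union_right _ hi))]
  | rel R ts =>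
    choose S hS using fun k => (ts k).exists_support
    refine ⟨Finset.univ.biUnion S, fun M v v' h w => ?_⟩
    simp only [Realize]
    have : (fun k => (ts k).eval M v w) = fun k => (ts k).eval M v' w := funext fun k =>
      hS k M v v' (fun i hi => h i (Finset.mem_biUnion.2 ⟨k, Finset.mem_univ k, hi⟩)) w
    rw [this]
  | neg φ ih =>
    obtain ⟨S, hS⟩ := ih
    exact ⟨S, fun M v v' h w => not_congr (hS M v v' h w)⟩
  | and φ ψ ih₁ ih₂ =>
    obtain ⟨S₁, h₁⟩ := ih₁
    obtain ⟨S₂, h₂⟩ := ih₂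
    exact ⟨S₁ ∪ S₂, fun M v v' h w => and_congr
      (h₁ M v v' (fun i hi => h i (Finset.mem_union_left _ hi)) w)
      (h₂ M v v' (fun i hi => h i (Finset.mem_union_right _ hi)) w)⟩
  | or φ ψ ih₁ ih₂ =>
    obtain ⟨S₁, h₁⟩ := ih₁
    obtain ⟨S₂, h₂⟩ := ih₂
    exact ⟨S₁ ∪ S₂, fun M v v' h w => or_congr
      (h₁ M v v' (fun i hi => h i (Finset.mem_union_left _ hi)) w)
      (h₂ M v v' (fun i hi => h i (Finset.mem_union_right _ hi)) w)⟩
  | ex s φ ih =>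
    obtain ⟨S, hS⟩ := ih
    exact ⟨S, fun M v v' h w => exists_congr fun a => hS M v v' h _⟩

open Classical in
/-- Existential quantification over the free variable `i`. -/
noncomputable def Formula.bind (i : I) (φ : Formula L x []) : Formula L x [] :=
  .ex (x i) (φ.subst
    (Function.update (fun j => .var j) i (.bvar (Δ := [x i]) (0 : Fin 1))) (fun k => k.elim0))

open Classical in
theorem Formula.sat_bind (M : LStructure L) (i : I) (φ : Formula L x []) (v : M.Tuple x) :
    M.Sat (φ.bind i) v ↔ ∃ a : M.carrier (x i), M.Sat φ (Function.update v i a) := by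
  unfold LStructure.Sat Formula.bind
  simp only [Realize]
  refine exists_congr fun a => ?_
  rw [realize_subst]
  refine iff_of_eq (congrArg₂ (fun p q => Formula.Realize M p φ q) (funext fun j => ?_)
    (funext fun k => k.elim0))
  by_cases h : j = i
  · subst h
    simp only [Function.update_self]
    rfl
  · simp only [Function.update_of_ne h]
    rfl

theorem Formula.IsPositive.bind (i : I) {φ : Formula L x []} (h : φ.IsPositive) :
    (φ.bind i).IsPositive :=
  .ex (h.subst _ _)

theorem Formula.IsPositive.exists_bind_finset {φ : Formula L x []} (h : φ.IsPositive)
    (S : Finset I) : ∃ ψ : Formula L x [], ψ.IsPositive ∧ ∀ (M : LStructure L) (v : M.Tuple x),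
      M.Sat ψ v ↔ ∃ v' : M.Tuple x, (∀ i, i ∉ S → v' i = v i) ∧ M.Sat φ v' := by
  classical
  induction S using Finset.induction_on with
  | empty =>
    refine ⟨φ, h, fun M v => ⟨fun hv => ⟨v, fun _ _ => rfl, hv⟩, ?_⟩⟩
    rintro ⟨v', h', hv⟩
    rwa [← funext fun i => h' i (Finset.notMem_empty i)]
  | insert k S hk ih =>
    obtain ⟨ψ, hψ, hM⟩ := ih
    refine ⟨ψ.bind k, hψ.bind k, fun M v => ?_⟩
    rw [Formula.sat_bind]
    constructor
    · rintro ⟨a, ha⟩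
      obtain ⟨v', h', hv⟩ := (hM M _).1 ha
      refine ⟨v', fun i hi => ?_, hv⟩
      rw [Finset.mem_insert, not_or] at hi
      rw [h' i hi.2, Function.update_of_ne hi.1]
    · rintro ⟨v', h', hv⟩
      refine ⟨v' k, (hM M _).2 ⟨v', fun i hi => ?_, hv⟩⟩
      by_cases hik : i = k
      · subst hik
        rw [Function.update_self]
      · rw [Function.update_of_ne hik]
        exact h' i (by simp [hik, hi])

/-- The tuple obtained by joining a tuple `a` of sort `x` and a tuple `b` of sort `y`. -/
def LStructure.join (M : LStructure L) (a : M.Tuple x) (b : M.Tuple y) :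
    M.Tuple (Sum.elim x y)
  | .inl i => a i
  | .inr i => b i

/-- The possibly infinite tuple `y` of variables can be quantified away from a positive formula,
as only finitely many of its members matter. The idle members have to be replaced by some term
in `x`, whence the hypothesis that there is one in each sort. -/
theorem Formula.IsPositive.exists_closure (hx : ∀ s, Nonempty (Term L x [] s))
    {φ : Formula L (Sum.elim x y) []} (h : φ.IsPositive) :
    ∃ ψ : Formula L x [], ψ.IsPositive ∧ ∀ (M : LStructure L) (a : M.Tuple x),
      M.Sat ψ a ↔ ∃ b : M.Tuple y, M.Sat φ (M.join a b) := by
  classical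
  obtain ⟨S, hS⟩ := φ.exists_support
  obtain ⟨ψ, hψ, hM⟩ := h.exists_bind_finset (S.filter fun i => i.isRight)
  let t : ∀ s, Term L x [] s := fun s => (hx s).some
  let σ : ∀ i : I ⊕ I', Term L x [] (Sum.elim x y i) := fun i => match i with
    | .inl i => .var i
    | .inr i => t (y i)
  refine ⟨ψ.subst σ (fun k => k.elim0), hψ.subst _ _, fun M a => ?_⟩
  have hσ : M.Sat (ψ.subst σ (fun k => k.elim0)) a ↔
      M.Sat ψ (M.join a fun i => (t (y i)).eval (Δ := []) M a (fun k => k.elim0)) := by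
    unfold LStructure.Sat
    rw [Formula.realize_subst]
    refine iff_of_eq (congrArg₂ (fun p q => Formula.Realize M p ψ q) (funext fun j => ?_)
      (funext fun k => k.elim0))
    cases j <;> rfl
  rw [hσ, hM]
  constructor
  · rintro ⟨v, hv, hφ⟩
    refine ⟨fun i => v (.inr i), ?_⟩
    have hav : M.join a (fun i => v (.inr i)) = v := by
      funext i
      cases i with
      | inl i => exact (hv (.inl i) (by simp)).symm
      | inr i => rfl
    exact (congrArg (M.Sat φ) hav).mpr hφ
  · rintro ⟨b, hb⟩
    -- Members of `b` outside the support are reset to the values of the idle terms.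
    refine ⟨fun i => if i ∈ S then M.join a b i else
      M.join a (fun i => (t (y i)).eval (Δ := []) M a (fun k => k.elim0)) i, fun i hi => ?_, ?_⟩
    · cases i with
      | inl i => simp [LStructure.join]
      | inr i =>
        exact if_neg (by simpa using hi)
    · -- The tuple agrees with `b` on the support of `φ`.
      refine (hS M _ _ (fun i hi => ?_) _).1 hb
      simp [hi]

end ExistentialClosure

/-! ### Homomorphisms and positive formulas -/

section Homomorphisms

variable {I : Type u} {x : I → L.Sorts} {M N P : LStructure L}

theorem LStructure.sat_iff (φ : Formula L x []) (v : M.Tuple x)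
    (w : ∀ k : Fin ([] : List L.Sorts).length, M.carrier (([] : List L.Sorts).get k)) :
    M.Sat φ v ↔ φ.Realize M v w :=
  iff_of_eq (congrArg (Formula.Realize M v φ) (funext fun k => k.elim0))

/-- The identity homomorphism. -/
def Hom.id (M : LStructure L) : Hom M M where
  toFun a := a
  map_const _ := rfl
  map_rel _ _ h := h
  map_loc _ _ _ h := h

/-- Composition of homomorphisms. -/
def Hom.comp (g : Hom N P) (f : Hom M N) : Hom M P where
  toFun a := g.toFun (f.toFun a)
  map_const c := by rw [f.map_const, g.map_const]
  map_rel R a h := g.map_rel R _ (f.map_rel R a h)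
  map_loc d a b h := g.map_loc d _ _ (f.map_loc d a b h)

theorem Hom.eval (f : Hom M N) {Δ : List L.Sorts} (v : M.Tuple x)
    (w : ∀ k : Fin Δ.length, M.carrier (Δ.get k)) {s : L.Sorts} (t : Term L x Δ s) :
    t.eval N (fun i => f.toFun (v i)) (fun k => f.toFun (w k)) = f.toFun (t.eval M v w) := by
  cases t with
  | var i => rfl
  | bvar k => rfl
  | const c => exact (f.map_const c).symm

theorem Hom.push (f : Hom M N) {Δ : List L.Sorts}
    (w : ∀ k : Fin Δ.length, M.carrier (Δ.get k)) {s : L.Sorts} (a : M.carrier s) :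
    N.push (f.toFun a) (fun k => f.toFun (w k)) = fun k => f.toFun (M.push a w k) := by
  funext k
  refine Fin.cases ?_ (fun k => ?_) k <;> rfl

theorem Hom.realize (f : Hom M N) {Δ : List L.Sorts} {φ : Formula L x Δ} (h : φ.IsPositive)
    (v : M.Tuple x) (w : ∀ k : Fin Δ.length, M.carrier (Δ.get k)) (hφ : φ.Realize M v w) :
    φ.Realize N (fun i => f.toFun (v i)) (fun k => f.toFun (w k)) := by
  induction h with
  | loc d t₁ t₂ =>
    simp only [Formula.Realize, f.eval]
    exact f.map_loc _ _ _ hφ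
  | rel R ts =>
    simp only [Formula.Realize, f.eval]
    exact f.map_rel _ _ hφ
  | and _ _ ih₁ ih₂ => exact ⟨ih₁ _ hφ.1, ih₂ _ hφ.2⟩
  | or _ _ ih₁ ih₂ => exact hφ.imp (ih₁ _) (ih₂ _)
  | ex _ ih =>
    obtain ⟨a, ha⟩ := hφ
    refine ⟨f.toFun a, ?_⟩
    rw [f.push]
    exact ih _ ha

theorem Hom.sat (f : Hom M N) {φ : Formula L x []} (h : φ.IsPositive) (v : M.Tuple x)
    (hφ : M.Sat φ v) : N.Sat φ (fun i => f.toFun (v i)) :=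
  (LStructure.sat_iff _ _ _).2 (f.realize h v _ hφ)

theorem Hom.IsPositiveEmbedding.models_of_isNegative {f : Hom M N} (hf : f.IsPositiveEmbedding)
    {φ : Sentence L} (h : φ.IsNegative) (hφ : M.Models φ) : N.Models φ := by
  obtain ⟨ψ, hψ, rfl⟩ := h
  refine fun hN => hφ (hf _ _ ψ _ hψ ?_)
  rwa [show (fun i : PEmpty.{u + 1} => f.toFun _) = (fun i => i.elim) from funext fun i => i.elim]

/-- A homomorphism with a retraction is a positive embedding. -/
theorem Hom.IsRetraction.isPositiveEmbedding {f : Hom M N} {g : Hom N M}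
    (h : f.IsRetraction g) : f.IsPositiveEmbedding := by
  intro I x φ a hφ hN
  have := g.sat hφ _ hN
  rwa [show (fun i => g.toFun (f.toFun (a i))) = a from funext fun i => h _ _] at this

end Homomorphisms

/-! ### Local ultrapowers -/

section LocalPower

variable (B : LStructure L) {J : Type u} (U : Ultrafilter J)

/-- A `J`-sequence in `B` is bounded along `U` if it stays in one locality of one element. -/
def LStructure.IsBounded {s : L.Sorts} (f : J → B.carrier s) : Prop :=
  ∃ (d : L.Loc s) (c : B.carrier s), ∀ᶠ j in U, B.loc d (f j) c

theorem LStructure.isBounded_const {s : L.Sorts} (c : B.carrier s) :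
    B.IsBounded U (fun _ : J => c) :=
  ⟨1, c, Filter.Eventually.of_forall fun _ => (B.loc_one c c).2 rfl⟩

/-- Equality of bounded sequences almost everywhere. -/
def LStructure.boundedSetoid (s : L.Sorts) :
    Setoid {f : J → B.carrier s // B.IsBounded U f} where
  r f g := ∀ᶠ j in U, f.1 j = g.1 j
  iseqv := ⟨fun _ => Filter.Eventually.of_forall fun _ => rfl, fun h => h.mono fun _ => Eq.symm,
    fun h h' => h.mp (h'.mono fun _ e' e => e.trans e')⟩

/-- The local ultrapower of `B`: the substructure of the ultrapower `B ^ J / U` that consists of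
the elements at bounded distance from the image of `B`. -/
noncomputable def LStructure.localPower : LStructure L where
  carrier s := Quotient (B.boundedSetoid U s)
  nonempty s := (B.nonempty s).map fun c => Quotient.mk _ ⟨_, B.isBounded_const U c⟩
  const c := Quotient.mk _ ⟨_, B.isBounded_const U (B.const c)⟩
  rel R a := ∀ᶠ j in U, B.rel R (fun k => (a k).out.1 j)
  loc d a b := ∀ᶠ j in U, B.loc d (a.out.1 j) (b.out.1 j)
  loc_one a b := by
    simp only [B.loc_one]
    exact (Quotient.out_equiv_out (x := a) (y := b))

variable {B}

/-- A sequence representing an element of the local ultrapower. -/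
noncomputable def LStructure.rep {s : L.Sorts} (a : (B.localPower U).carrier s) (j : J) :
    B.carrier s :=
  (Quotient.out (s := B.boundedSetoid U s) a).1 j

theorem LStructure.isBounded_rep {s : L.Sorts} (a : (B.localPower U).carrier s) :
    B.IsBounded U (LStructure.rep U a) :=
  (Quotient.out (s := B.boundedSetoid U s) a).2

/-- The element of the local ultrapower represented by a bounded sequence. -/
def LStructure.powerMk {s : L.Sorts} (f : J → B.carrier s) (hf : B.IsBounded U f) :
    (B.localPower U).carrier s :=
  Quotient.mk (B.boundedSetoid U s) ⟨f, hf⟩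

theorem LStructure.rep_powerMk {s : L.Sorts} (f : J → B.carrier s) (hf : B.IsBounded U f) :
    ∀ᶠ j in U, LStructure.rep U (LStructure.powerMk U f hf) j = f j :=
  Quotient.mk_out (s := B.boundedSetoid U s) ⟨f, hf⟩

theorem LStructure.powerMk_eq {s : L.Sorts} {f g : J → B.carrier s} (hf : B.IsBounded U f)
    (hg : B.IsBounded U g) (h : ∀ᶠ j in U, f j = g j) :
    LStructure.powerMk U f hf = LStructure.powerMk U g hg :=
  Quotient.sound (s := B.boundedSetoid U s) h

theorem LStructure.localPower_loc {s : L.Sorts} (d : L.Loc s)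
    (a b : (B.localPower U).carrier s) : (B.localPower U).loc d a b ↔
      ∀ᶠ j in U, B.loc d (LStructure.rep U a j) (LStructure.rep U b j) :=
  Iff.rfl

theorem LStructure.localPower_rel {w : List L.Sorts} (R : L.Rel w)
    (a : ∀ k : Fin w.length, (B.localPower U).carrier (w.get k)) : (B.localPower U).rel R a ↔
      ∀ᶠ j in U, B.rel R (fun k => LStructure.rep U (a k) j) :=
  Iff.rfl

theorem LStructure.localPower_const {s : L.Sorts} (c : L.Const s) :
    (B.localPower U).const c = LStructure.powerMk U _ (B.isBounded_const U (B.const c)) :=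
  rfl

theorem LStructure.IsLocal.localPower (hB : B.IsLocal) : (B.localPower U).IsLocal where
  symm d a b h := Filter.Eventually.mono h fun _ => hB.symm d _ _
  mono d₁ d₂ hd a b h := Filter.Eventually.mono h fun _ => hB.mono d₁ d₂ hd _ _
  comp d₁ d₂ a b c h h' := Filter.Eventually.mp h (Filter.Eventually.mono h' fun _ q p =>
    hB.comp d₁ d₂ _ _ _ p q)
  bound c₁ c₂ := by
    rw [LStructure.localPower_loc, LStructure.localPower_const, LStructure.localPower_const]
    filter_upwards [LStructure.rep_powerMk U _ (B.isBounded_const U (B.const c₁)),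
      LStructure.rep_powerMk U _ (B.isBounded_const U (B.const c₂))] with j h₁ h₂
    rw [h₁, h₂]
    exact hB.bound c₁ c₂
  total a b := by
    obtain ⟨d, c, h⟩ := LStructure.isBounded_rep U a
    obtain ⟨d', c', h'⟩ := LStructure.isBounded_rep U b
    obtain ⟨e, he⟩ := hB.total c c'
    refine ⟨d * e * d', (LStructure.localPower_loc U _ _ _).2 ?_⟩
    filter_upwards [h, h'] with j hj hj'
    exact hB.comp _ _ _ _ _ (hB.comp _ _ _ _ _ hj he) (hB.symm _ _ _ hj')

section Los

variable {I : Type u} {x : I → L.Sorts}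

theorem LStructure.eval_localPower {Δ : List L.Sorts} (v : (B.localPower U).Tuple x)
    (w : ∀ k : Fin Δ.length, (B.localPower U).carrier (Δ.get k)) {s : L.Sorts}
    (t : Term L x Δ s) : ∀ᶠ j in U, LStructure.rep U (t.eval (B.localPower U) v w) j =
      t.eval B (fun i => LStructure.rep U (v i) j) (fun k => LStructure.rep U (w k) j) := by
  cases t with
  | var i => exact Filter.Eventually.of_forall fun _ => rfl
  | bvar k => exact Filter.Eventually.of_forall fun _ => rfl
  | const c => exact LStructure.rep_powerMk U _ (B.isBounded_const U (B.const c))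

theorem LStructure.rep_push {Δ : List L.Sorts}
    (w : ∀ k : Fin Δ.length, (B.localPower U).carrier (Δ.get k)) {s : L.Sorts}
    (a : (B.localPower U).carrier s) (j : J) :
    (fun k => LStructure.rep U ((B.localPower U).push a w k) j) =
      B.push (LStructure.rep U a j) (fun k => LStructure.rep U (w k) j) := by
  funext k
  refine Fin.cases ?_ (fun k => ?_) k <;> rfl

theorem LStructure.realize_loc_localPower {Δ : List L.Sorts} (v : (B.localPower U).Tuple x)
    (w : ∀ k : Fin Δ.length, (B.localPower U).carrier (Δ.get k)) {s : L.Sorts} (d : L.Loc s)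
    (t₁ t₂ : Term L x Δ s) :
    (Formula.loc d t₁ t₂).Realize (B.localPower U) v w ↔ ∀ᶠ j in U,
      (Formula.loc d t₁ t₂).Realize B (fun i => LStructure.rep U (v i) j)
        (fun k => LStructure.rep U (w k) j) := by
  simp only [Formula.Realize, LStructure.localPower_loc]
  refine Filter.eventually_congr ?_
  filter_upwards [LStructure.eval_localPower U v w t₁, LStructure.eval_localPower U v w t₂]
    with j h₁ h₂
  rw [h₁, h₂]

theorem LStructure.realize_rel_localPower {Δ : List L.Sorts} (v : (B.localPower U).Tuple x)
    (w : ∀ k : Fin Δ.length, (B.localPower U).carrier (Δ.get k)) {z : List L.Sorts}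
    (R : L.Rel z) (ts : ∀ k : Fin z.length, Term L x Δ (z.get k)) :
    (Formula.rel R ts).Realize (B.localPower U) v w ↔ ∀ᶠ j in U,
      (Formula.rel R ts).Realize B (fun i => LStructure.rep U (v i) j)
        (fun k => LStructure.rep U (w k) j) := by
  simp only [Formula.Realize, LStructure.localPower_rel]
  refine Filter.eventually_congr ?_
  filter_upwards [Filter.eventually_all.2 fun k => LStructure.eval_localPower U v w (ts k)]
    with j hj
  rw [funext hj]

/-- Half of Łoś's theorem: positive formulas descend from the local ultrapower to `B`. -/
theorem LStructure.eventually_realize_of_localPower {Δ : List L.Sorts} {φ : Formula L x Δ}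
    (h : φ.IsPositive) (v : (B.localPower U).Tuple x)
    (w : ∀ k : Fin Δ.length, (B.localPower U).carrier (Δ.get k))
    (hφ : φ.Realize (B.localPower U) v w) :
    ∀ᶠ j in U, φ.Realize B (fun i => LStructure.rep U (v i) j)
      (fun k => LStructure.rep U (w k) j) := by
  induction h with
  | loc d t₁ t₂ => exact (LStructure.realize_loc_localPower U v w d t₁ t₂).1 hφ
  | rel R ts => exact (LStructure.realize_rel_localPower U v w R ts).1 hφ
  | and _ _ ih₁ ih₂ => exact (ih₁ w hφ.1).and (ih₂ w hφ.2)
  | or _ _ ih₁ ih₂ =>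
    exact hφ.elim (fun h => (ih₁ w h).mono fun _ => Or.inl) fun h => (ih₂ w h).mono fun _ => Or.inr
  | ex _ ih =>
    obtain ⟨a, ha⟩ := hφ
    refine (ih _ ha).mono fun j hj => ⟨LStructure.rep U a j, ?_⟩
    rwa [LStructure.rep_push] at hj

/-- The other half of Łoś's theorem holds for local positive formulas, since the witnesses of a
local quantifier stay at bounded distance. -/
theorem LStructure.IsLocal.realize_localPower (hB : B.IsLocal) {Δ : List L.Sorts}
    {φ : Formula L x Δ} (h : φ.IsLocalPositive) (v : (B.localPower U).Tuple x)
    (w : ∀ k : Fin Δ.length, (B.localPower U).carrier (Δ.get k))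
    (hφ : ∀ᶠ j in U, φ.Realize B (fun i => LStructure.rep U (v i) j)
      (fun k => LStructure.rep U (w k) j)) :
    φ.Realize (B.localPower U) v w := by
  induction h with
  | loc d t₁ t₂ => exact (LStructure.realize_loc_localPower U v w d t₁ t₂).2 hφ
  | rel R ts => exact (LStructure.realize_rel_localPower U v w R ts).2 hφ
  | and _ _ ih₁ ih₂ =>
    exact ⟨ih₁ w (hφ.mono fun _ => And.left), ih₂ w (hφ.mono fun _ => And.right)⟩
  | or _ _ ih₁ ih₂ =>
    exact (Ultrafilter.eventually_or.1 hφ).imp (ih₁ w) (ih₂ w)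
  | @localEx Δ s d t φ _ ih =>
    -- The witnesses in `B` form a sequence, which is bounded since the value of `t` is.
    have hφ' : ∀ᶠ j in U, ∃ b : B.carrier s,
        B.loc d b (LStructure.rep U (t.eval (B.localPower U) v w) j) ∧
        φ.Realize B (fun i => LStructure.rep U (v i) j)
          (B.push b (fun k => LStructure.rep U (w k) j)) := by
      filter_upwards [hφ, LStructure.eval_localPower U v w t] with j hj ht
      obtain ⟨b, hb, hb'⟩ := hj
      refine ⟨b, ?_, hb'⟩
      have hb : B.loc d b ((t.weaken s).eval B _ (B.push b _)) := hb
      rw [Term.eval_weaken] at hb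
      rwa [ht]
    have : ∃ f : J → B.carrier s, ∀ᶠ j in U,
        B.loc d (f j) (LStructure.rep U (t.eval (B.localPower U) v w) j) ∧
        φ.Realize B (fun i => LStructure.rep U (v i) j)
          (B.push (f j) (fun k => LStructure.rep U (w k) j)) := by
      have := B.nonempty s
      exact ⟨fun j => Classical.epsilon _, hφ'.mono fun j hj => Classical.epsilon_spec hj⟩
    obtain ⟨f, hf⟩ := this
    have hfb : B.IsBounded U f := by
      obtain ⟨e, c, h⟩ := LStructure.isBounded_rep U (t.eval (B.localPower U) v w)
      exact ⟨d * e, c, by filter_upwards [hf, h] with j hj hj' using hB.comp _ _ _ _ _ hj.1 hj'⟩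
    refine ⟨LStructure.powerMk U f hfb, ?_, ?_⟩
    · change (B.localPower U).loc d _ ((t.weaken s).eval _ v ((B.localPower U).push _ w))
      rw [Term.eval_weaken, LStructure.localPower_loc]
      filter_upwards [hf, LStructure.rep_powerMk U f hfb] with j hj hr
      have hj := hj.1
      rw [← hr] at hj
      exact hj
    · refine ih _ ?_
      filter_upwards [hf, LStructure.rep_powerMk U f hfb] with j hj hr
      rw [LStructure.rep_push, hr]
      exact hj.2

end Los

variable (B)

/-- The diagonal embedding of `B` in its local ultrapower. -/
def LStructure.diagonal : Hom B (B.localPower U) where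
  toFun a := LStructure.powerMk U _ (B.isBounded_const U a)
  map_const _ := rfl
  map_rel R a h := by
    rw [LStructure.localPower_rel]
    filter_upwards [Filter.eventually_all.2 fun k =>
      LStructure.rep_powerMk U _ (B.isBounded_const U (a k))] with j hj
    rwa [funext hj]
  map_loc d a b h := by
    rw [LStructure.localPower_loc]
    filter_upwards [LStructure.rep_powerMk U _ (B.isBounded_const U a),
      LStructure.rep_powerMk U _ (B.isBounded_const U b)] with j h₁ h₂
    rwa [h₁, h₂]

/-- Positive formulas descend to `B` almost everywhere. For an infinite tuple the representatives
of the diagonal elements need not be simultaneously constant anywhere, but on the finite support of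
the formula they are, almost everywhere. -/
theorem LStructure.isPositiveEmbedding_diagonal : (B.diagonal U).IsPositiveEmbedding := by
  intro I x φ a hφ h
  obtain ⟨S, hS⟩ := φ.exists_support
  have h₁ := LStructure.eventually_realize_of_localPower U hφ _ _ h
  have h₂ : ∀ᶠ j in U, ∀ i ∈ S, LStructure.rep U ((B.diagonal U).toFun (a i)) j = a i :=
    (Filter.eventually_all_finset S).2 fun i _ => LStructure.rep_powerMk U _ _
  obtain ⟨j, hj, hj'⟩ := (h₁.and h₂).exists
  rw [hS B _ _ hj'] at hj
  exact (LStructure.sat_iff _ _ _).2 hj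

/-- A downward directed family of satisfiable conditions holds along an ultrafilter. For `J` the set
of tuples of a structure, this is the form in which compactness is used: the tautological sequence
`v ↦ v i` of `J`-indexed values then represents the `i`-th member of a tuple in the ultrapower. -/
theorem exists_ultrafilter_of_directed {K : Type u} [Nonempty J] (p : K → J → Prop)
    (hp : ∀ k, ∃ j, p k j) (hd : ∀ k k', ∃ l, ∀ j, p l j → p k j ∧ p k' j) :
    ∃ U : Ultrafilter J, ∀ k, ∀ᶠ j in U, p k j := by
  have : (⨅ k, Filter.principal {j | p k j}).NeBot := by
    refine Filter.iInf_neBot_of_directed (fun k k' => ?_) fun k => ?_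
    · obtain ⟨l, hl⟩ := hd k k'
      exact ⟨l, Filter.principal_mono.2 fun j hj => (hl j hj).1,
        Filter.principal_mono.2 fun j hj => (hl j hj).2⟩
    · exact Filter.principal_neBot_iff.2 (hp k)
  refine ⟨Ultrafilter.of (⨅ k, Filter.principal {j | p k j}), fun k => ?_⟩
  exact Ultrafilter.of_le _ (Filter.mem_iInf_of_mem k (Filter.mem_principal_self _))

end LocalPower

/-! ### Amalgamation -/

section Amalgamation

/-- If every positive formula true of `r` in `R` is true of `b` in `B`, then `R` and `B` can be
amalgamated over `r ↦ b`, and `B` embeds positively in the amalgam. The amalgam is a local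
ultrapower of `B`; since there is a term in `x` in each sort, every element of `R` is at bounded
distance from a member of `r`, which is why its image does not leave the local ultrapower. -/
theorem exists_amalgam {I : Type u} {x : I → L.Sorts} (hx : ∀ s, Nonempty (Term L x [] s))
    {R B : LStructure L} (hR : R.IsLocal) (hB : B.IsLocal) (r : R.Tuple x) (b : B.Tuple x)
    (h : ∀ φ : Formula L x [], φ.IsPositive → R.Sat φ r → B.Sat φ b) :
    ∃ N : LStructure L, N.IsLocal ∧ ∃ (j : Hom R N) (k : Hom B N), k.IsPositiveEmbedding ∧
      ∀ i, j.toFun (r i) = k.toFun (b i) := by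
  -- The ultrapower is indexed by the assignments in `B` of values to the elements of `R`; the
  -- conditions are the positive formulas true in `R`, with the tuple `r` interpreted by `b`.
  let y : (Σ s, R.carrier s) → L.Sorts := Sigma.fst
  let e : R.Tuple y := fun a => a.2
  have : Nonempty (B.Tuple y) := ⟨fun a => (B.nonempty a.1).some⟩
  obtain ⟨U, hU⟩ := exists_ultrafilter_of_directed (J := B.Tuple y)
    (K := {φ : Formula L (Sum.elim x y) [] // φ.IsPositive ∧ R.Sat φ (R.join r e)})
    (fun φ v => B.Sat φ.1 (B.join b v))
    (by
      rintro ⟨φ, hφ, hφR⟩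
      obtain ⟨ψ, hψ, hM⟩ := hφ.exists_closure hx
      exact (hM B b).1 (h ψ hψ ((hM R r).2 ⟨e, hφR⟩)))
    (fun φ ψ => ⟨⟨.and φ.1 ψ.1, .and φ.2.1 ψ.2.1, φ.2.2, ψ.2.2⟩, fun _ hv => hv⟩)
  replace hU : ∀ φ : Formula L (Sum.elim x y) [], φ.IsPositive → R.Sat φ (R.join r e) →
      ∀ᶠ v in U, B.Sat φ (B.join b v) := fun φ h₁ h₂ => hU ⟨φ, h₁, h₂⟩
  let t : ∀ {s : L.Sorts}, R.carrier s → Term L (Sum.elim x y) [] s := fun {s} a =>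
    .var (x := Sum.elim x y) (.inr ⟨s, a⟩)
  have hb : ∀ {s : L.Sorts} (a : R.carrier s), B.IsBounded U (fun v : B.Tuple y => v ⟨s, a⟩) := by
    intro s a
    obtain ⟨c⟩ := hx s
    let c' : Term L (Sum.elim x y) [] s :=
      c.subst (fun i => .var (x := Sum.elim x y) (.inl i)) (fun k : Fin 0 => k.elim0)
    obtain ⟨d, hd⟩ := hR.total a (c'.eval R (R.join r e) (fun k : Fin 0 => k.elim0))
    refine ⟨d, c.eval B b (fun k : Fin 0 => k.elim0), ?_⟩
    refine (hU (.loc d (t a) c') (.loc _ _ _) hd).mono fun v hv => ?_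
    have hc' : c'.eval B (B.join b v) (fun k : Fin 0 => k.elim0) =
        c.eval B b (fun k : Fin 0 => k.elim0) := by
      rcases c with _ | k | _
      · rfl
      · exact k.elim0
      · rfl
    rw [← hc']
    exact hv
  refine ⟨B.localPower U, hB.localPower U,
    { toFun := fun {s} a => LStructure.powerMk U _ (hb a)
      map_const := fun {s} c => ?_
      map_rel := fun {w} S a ha => ?_
      map_loc := fun {s} d a a' ha => ?_ }, B.diagonal U, B.isPositiveEmbedding_diagonal U,
    fun i => ?_⟩
  · refine LStructure.powerMk_eq U _ _ ?_
    exact (hU (.loc 1 (t (R.const c)) (.const c)) (.loc _ _ _) ((R.loc_one _ _).2 rfl)).mono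
      fun v hv => (B.loc_one _ _).1 hv
  · rw [LStructure.localPower_rel]
    filter_upwards [hU (.rel S fun k => t (a k)) (.rel _ _) ha,
      Filter.eventually_all.2 fun k => LStructure.rep_powerMk U _ (hb (a k))] with v hv hv'
    rw [funext hv']
    exact hv
  · rw [LStructure.localPower_loc]
    filter_upwards [hU (.loc d (t a) (t a')) (.loc _ _ _) ha, LStructure.rep_powerMk U _ (hb a),
      LStructure.rep_powerMk U _ (hb a')] with v hv h₁ h₂
    rw [h₁, h₂]
    exact hv
  · refine LStructure.powerMk_eq U _ _ ?_
    exact (hU (.loc 1 (t (r i)) (.var (x := Sum.elim x y) (.inl i))) (.loc _ _ _)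
      ((R.loc_one _ _).2 rfl)).mono fun v hv => (B.loc_one _ _).1 hv

/-- Ultrahomogeneity of retractors: amalgamate over `A`, then retract the amalgam. -/
theorem LStructure.IsRetractor.isAbsolutelyUltrahomogeneous {T : Set (Sentence L)}
    (hT : ∀ φ ∈ T, φ.IsNegative) {R : LStructure L} (hR : R.IsRetractor T) :
    R.IsAbsolutelyUltrahomogeneous T := by
  refine fun κ => ⟨hR.1, fun A B hB _ _ f g hf => ?_⟩
  obtain ⟨N, hN, j, k, hk, hjk⟩ := exists_amalgam (x := fun a : Σ s, A.carrier s => a.1)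
    (fun s => (A.nonempty s).map fun a => .var (x := fun a : Σ s, A.carrier s => a.1) ⟨s, a⟩)
    hR.1.1 hB.1 (fun a => f.toFun a.2) (fun a => g.toFun a.2)
    (fun φ hφ h => g.sat hφ _ (hf _ _ φ _ hφ h))
  obtain ⟨ρ, hρ⟩ := hR.2 N ⟨hN, fun φ hφ => hk.models_of_isNegative (hT φ hφ) (hB.2 φ hφ)⟩ j
  refine ⟨ρ.comp k, fun s a => ?_⟩
  have := hjk ⟨s, a⟩
  exact (congrArg ρ.toFun this).symm.trans (hρ s (f.toFun a))

theorem LStructure.IsAbsolutelyUltrahomogeneous.isRetractor {T : Set (Sentence L)}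
    {R : LStructure L} (hR : R.IsAbsolutelyUltrahomogeneous T) : R.IsRetractor T := by
  refine ⟨(hR 0).1, fun N hN f => ?_⟩
  obtain ⟨g, hg⟩ := (hR (Order.succ (max R.card N.card))).2 R N hN
    (Order.lt_succ_of_le (le_max_left _ _)) (Order.lt_succ_of_le (le_max_right _ _))
    (Hom.id R) f (Hom.IsRetraction.isPositiveEmbedding (g := Hom.id R) fun _ _ => rfl)
  exact ⟨g, hg⟩

end Amalgamation

/-! ### Negative theories of structures with constants in each sort -/

section NegativeTheory

variable {R N : LStructure L}

/-- Positive sentences true in a local model of `Th₋(R)` are true in `R`. -/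
theorem LStructure.IsLocalModel.models_of_isPositive (hN : N.IsLocalModel R.negTheory)
    {φ : Sentence L} (hφ : φ.IsPositive) (h : N.Models φ) : R.Models φ := by
  by_contra hR
  exact hN.2 (.neg φ) ⟨⟨φ, hφ, rfl⟩, hR⟩ h

theorem LStructure.IsLocal.isLocalModel_negTheory (hR : R.IsLocal) :
    R.IsLocalModel R.negTheory :=
  ⟨hR, fun _ hφ => hφ.2⟩

/-- Local models `A`, `B` of `Th₋(R)` map to a common one: `A` maps to an amalgam in which `R`
embeds positively, and an amalgam of `B` with the latter is still a model of `Th₋(R)`. -/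
theorem LStructure.IsLocal.localJointProperty_negTheory (hR : R.IsLocal)
    (hc : ∀ s, Nonempty (L.Const s)) : LocalJointProperty R.negTheory := by
  intro A B hA hB
  have hx : ∀ s, Nonempty (Term L (fun i : PEmpty.{u + 1} => (i.elim : L.Sorts)) [] s) :=
    fun s => (hc s).map .const
  obtain ⟨P, hP, a, k, hk, -⟩ := exists_amalgam hx hA.1 hR (fun i => i.elim) (fun i => i.elim)
    fun φ hφ h => hA.models_of_isPositive hφ h
  have hPT : ∀ φ ∈ R.negTheory, P.Models φ := fun φ hφ => hk.models_of_isNegative hφ.1 hφ.2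
  have hRP : ∀ φ : Sentence L, φ.IsPositive → R.Models φ → P.Models φ := by
    intro φ hφ h
    have := k.sat hφ _ h
    rwa [show (fun i : PEmpty.{u + 1} => k.toFun _) = (fun i => i.elim) from
      funext fun i => i.elim] at this
  obtain ⟨Q, hQ, b, l, hl, -⟩ := exists_amalgam hx hB.1 hP (fun i => i.elim) (fun i => i.elim)
    fun φ hφ h => hRP φ hφ (hB.models_of_isPositive hφ h)
  exact ⟨Q, ⟨hQ, fun φ hφ => hl.models_of_isNegative hφ.1 (hPT φ hφ)⟩, ⟨l.comp a⟩, ⟨b⟩⟩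

theorem Formula.IsPositive.exists_sentence (hc : ∀ s, Nonempty (L.Const s)) {I : Type u}
    {x : I → L.Sorts} {φ : Formula L x []} (h : φ.IsPositive) :
    ∃ ψ : Sentence L, ψ.IsPositive ∧
      ∀ M : LStructure L, M.Models ψ ↔ ∃ v : M.Tuple x, M.Sat φ v := by
  have hx : ∀ s, Nonempty (Term L (fun i : PEmpty.{u + 1} => (i.elim : L.Sorts)) [] s) :=
    fun s => (hc s).map .const
  obtain ⟨ψ, hψ, hM⟩ := (h.subst (y := Sum.elim (fun i : PEmpty.{u + 1} => (i.elim : L.Sorts)) x)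
    (fun i => .var (x := Sum.elim _ x) (.inr i)) (fun k => k.elim0)).exists_closure hx
  refine ⟨ψ, hψ, fun M => (hM M _).trans (exists_congr fun v => ?_)⟩
  exact (Formula.realize_subst M φ _ _ _ _).trans (LStructure.sat_iff _ _ _).symm

/-- The local positive formulas true of a tuple in a local model of `Th₋(R)` extend to a local
positive type. Unions of chains of arbitrary partial types need not be partial types, as a tuple
may escape to infinity; here the given formulas bound each variable by a constant. -/
theorem LStructure.IsLocal.exists_isLocalPosType (hR : R.IsLocal)
    (hc : ∀ s, Nonempty (L.Const s)) (hN : N.IsLocalModel R.negTheory) {I : Type u}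
    {x : I → L.Sorts} (a : N.Tuple x) :
    ∃ p, IsLocalPosType R.negTheory x p ∧
      ∀ φ : Formula L x [], φ.IsLocalPositive → N.Sat φ a → φ ∈ p := by
  let Γ : Set (Formula L x []) := {φ | φ.IsLocalPositive ∧ N.Sat φ a}
  have hΓ : IsPartialLocalPosType R.negTheory x Γ :=
    ⟨fun φ hφ => hφ.1, N, hN, a, fun φ hφ => hφ.2⟩
  obtain ⟨p, hΓp, hp⟩ := zorn_subset_nonempty
    {q | IsPartialLocalPosType R.negTheory x q ∧ Γ ⊆ q} (fun C hC hchain hne => by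
      refine ⟨⋃₀ C, ⟨⟨fun φ ⟨q, hq, hφ⟩ => (hC hq).1.1 φ hφ, ?_⟩, ?_⟩,
        fun q hq => Set.subset_sUnion_of_mem hq⟩
      swap
      · obtain ⟨q, hq⟩ := hne
        exact (hC hq).2.trans (Set.subset_sUnion_of_mem hq)
      have : Nonempty (R.Tuple x) := ⟨fun i => (R.nonempty (x i)).some⟩
      -- The positive consequences of the members of the chain are closed under conjunction.
      obtain ⟨U, hU⟩ := exists_ultrafilter_of_directed (J := R.Tuple x)
        (K := {φ : Formula L x [] // φ.IsPositive ∧ ∃ q ∈ C, ∀ M : LStructure L,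
          ∀ v : M.Tuple x, (∀ ψ ∈ q, M.Sat ψ v) → M.Sat φ v})
        (fun φ v => R.Sat φ.1 v)
        (by
          rintro ⟨φ, hφ, q, hq, h⟩
          obtain ⟨ψ, hψ, hM⟩ := hφ.exists_sentence hc
          obtain ⟨-, M, hMR, v, hv⟩ := (hC hq).1
          exact (hM R).1 (hMR.models_of_isPositive hψ ((hM M).2 ⟨v, h M v hv⟩)))
        (by
          rintro ⟨φ, hφ, q, hq, h⟩ ⟨φ', hφ', q', hq', h'⟩
          obtain hle | hle := hchain.total hq hq'
          · exact ⟨⟨.and φ φ', .and hφ hφ', q', hq', fun M v hv =>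
              ⟨h M v fun ψ hψ => hv ψ (hle hψ), h' M v hv⟩⟩, fun _ hv => hv⟩
          · exact ⟨⟨.and φ φ', .and hφ hφ', q, hq, fun M v hv =>
              ⟨h M v hv, h' M v fun ψ hψ => hv ψ (hle hψ)⟩⟩, fun _ hv => hv⟩)
      replace hU : ∀ q ∈ C, ∀ φ ∈ q, ∀ᶠ v in U, R.Sat φ v := fun q hq φ hφ =>
        hU ⟨φ, ((hC hq).1.1 φ hφ).isPositive, q, hq, fun M v hv => hv φ hφ⟩
      -- `Γ` contains a bound of each variable by a constant.
      have hb : ∀ i, R.IsBounded U (fun v : R.Tuple x => v i) := by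
        intro i
        obtain ⟨c⟩ := hc (x i)
        obtain ⟨d, hd⟩ := hN.1.total (a i) (N.const c)
        obtain ⟨q, hq⟩ := hne
        exact ⟨d, R.const c, hU q hq (.loc d (.var i) (.const c)) ((hC hq).2 ⟨.loc _ _ _, hd⟩)⟩
      refine ⟨R.localPower U, ⟨hR.localPower U, fun φ hφ =>
        (R.isPositiveEmbedding_diagonal U).models_of_isNegative hφ.1 hφ.2⟩,
        fun i => LStructure.powerMk U _ (hb i), fun φ ⟨q, hq, hφ⟩ => ?_⟩
      obtain ⟨S, hS⟩ := φ.exists_support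
      refine hR.realize_localPower U ((hC hq).1.1 φ hφ) _ _ ?_
      filter_upwards [hU q hq φ hφ, (Filter.eventually_all_finset S).2 fun i _ =>
        LStructure.rep_powerMk U _ (hb i)] with v hv hv'
      rw [hS R _ v hv']
      exact (LStructure.sat_iff _ _ _).1 hv) Γ ⟨hΓ, subset_rfl⟩
  exact ⟨p, ⟨hp.prop.1, fun q hq hpq => hp.le_of_ge ⟨hq, hΓp.trans hpq⟩ hpq⟩,
    fun φ h₁ h₂ => hΓp ⟨h₁, h₂⟩⟩

end NegativeTheory

/-! ### Parameters -/

section Parameters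

variable {M : LStructure L} {A : ∀ s, Set (M.carrier s)} {β : M.ParamBound A}
  {I : Type u} {x : I → L.Sorts}

/-- The reduct to `L` of an `L(A)`-structure. -/
def paramReduct (N : LStructure (M.paramLanguage A β)) : LStructure L where
  carrier := N.carrier
  nonempty := N.nonempty
  const c := N.const (.inl c)
  rel := N.rel
  loc := N.loc
  loc_one := N.loc_one

theorem LStructure.IsLocal.paramReduct {N : LStructure (M.paramLanguage A β)} (hN : N.IsLocal) :
    (paramReduct N).IsLocal where
  symm := hN.symm
  mono := hN.mono
  comp := hN.comp
  bound c₁ c₂ := by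
    rw [← β.extends_bound]
    exact hN.bound (.inl c₁) (.inl c₂)
  total := hN.total

/-- A homomorphism of `L(A)`-structures, as a homomorphism of their reducts to `L`. -/
def Hom.reduct {N P : LStructure (M.paramLanguage A β)} (f : Hom N P) :
    Hom (paramReduct N) (paramReduct P) where
  toFun := f.toFun
  map_const c := f.map_const (.inl c)
  map_rel := f.map_rel
  map_loc := f.map_loc

/-- A term of `L`, as a term of `L(A)`. -/
def Term.withParams (β : M.ParamBound A) {Δ : List L.Sorts} :
    {s : L.Sorts} → Term L x Δ s → Term (M.paramLanguage A β) x Δ s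
  | _, .var i => .var (L := M.paramLanguage A β) i
  | _, .bvar k => .bvar (L := M.paramLanguage A β) k
  | _, .const c => .const (L := M.paramLanguage A β) (.inl c)

/-- A formula of `L`, as a formula of `L(A)`. -/
def Formula.withParams (β : M.ParamBound A) :
    {Δ : List L.Sorts} → Formula L x Δ → Formula (M.paramLanguage A β) x Δ
  | _, .loc d t₁ t₂ => .loc (L := M.paramLanguage A β) d (t₁.withParams β) (t₂.withParams β)
  | _, .rel R ts => .rel (L := M.paramLanguage A β) R (fun k => (ts k).withParams β)
  | _, .neg φ => .neg (φ.withParams β)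
  | _, .and φ ψ => .and (φ.withParams β) (ψ.withParams β)
  | _, .or φ ψ => .or (φ.withParams β) (ψ.withParams β)
  | _, .ex s φ => .ex (L := M.paramLanguage A β) s (φ.withParams β)

theorem Term.eval_withParams (N : LStructure (M.paramLanguage A β)) {Δ : List L.Sorts}
    (v : (paramReduct N).Tuple x) (w : ∀ k : Fin Δ.length, (paramReduct N).carrier (Δ.get k))
    {s : L.Sorts} (t : Term L x Δ s) :
    (t.withParams β).eval N v w = t.eval (paramReduct N) v w := by
  cases t <;> rfl

theorem Formula.realize_withParams (N : LStructure (M.paramLanguage A β)) {Δ : List L.Sorts}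
    (v : (paramReduct N).Tuple x) (w : ∀ k : Fin Δ.length, (paramReduct N).carrier (Δ.get k))
    (φ : Formula L x Δ) : (φ.withParams β).Realize N v w ↔ φ.Realize (paramReduct N) v w := by
  induction φ with
  | loc d t₁ t₂ =>
    simp only [withParams, Realize, Term.eval_withParams]
    rfl
  | rel R ts =>
    simp only [withParams, Realize, Term.eval_withParams]
    rfl
  | neg φ ih => exact not_congr (ih w)
  | and φ ψ ih₁ ih₂ => exact and_congr (ih₁ w) (ih₂ w)
  | or φ ψ ih₁ ih₂ => exact or_congr (ih₁ w) (ih₂ w)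
  | ex s φ ih => exact exists_congr fun a => ih ((paramReduct N).push a w)

theorem Formula.IsPositive.withParams {Δ : List L.Sorts} {φ : Formula L x Δ}
    (h : φ.IsPositive) : (φ.withParams β).IsPositive := by
  induction h with
  | loc d t₁ t₂ => exact .loc _ _ _
  | rel R ts => exact .rel _ _
  | and _ _ ih₁ ih₂ => exact .and ih₁ ih₂
  | or _ _ ih₁ ih₂ => exact .or ih₁ ih₂
  | ex _ ih => exact .ex ih

/-- `Th₋(M/A)` contains the negative sentences of `L` true in `M`, in particular those of `T`. -/
theorem LStructure.IsLocalModel.paramReduct {T : Set (Sentence L)} (hT : ∀ φ ∈ T, φ.IsNegative)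
    (hM : M.IsLocalModel T) {N : LStructure (M.paramLanguage A β)}
    (hN : N.IsLocalModel (M.negTheoryOver A β)) : (paramReduct N).IsLocalModel T := by
  refine ⟨hN.1.paramReduct, fun φ hφ => ?_⟩
  obtain ⟨ψ, hψ, rfl⟩ := hT φ hφ
  intro hN'
  have hN'' := (Formula.realize_withParams N _ _ ψ).2 hN'
  refine hM.2 _ hφ ((Formula.realize_withParams (M.paramExpansion A β) _ _ ψ).1 ?_)
  by_contra h
  exact hN.2 _ ⟨⟨_, hψ.withParams, rfl⟩, h⟩ hN''

/-- A term of `L(A)`, with the new constants replaced by new variables. -/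
def Term.freeParams {Δ : List L.Sorts} :
    {s : L.Sorts} → Term (M.paramLanguage A β) x Δ s →
      Term L (Sum.elim x fun a : Σ s, A s => a.1) Δ s
  | _, .var i => .var (x := Sum.elim x fun a : Σ s, A s => a.1) (.inl i)
  | _, .bvar k => .bvar (L := L) k
  | _, .const (.inl c) => .const (L := L) c
  | s, .const (.inr a) => .var (x := Sum.elim x fun a : Σ s, A s => a.1) (.inr ⟨s, a⟩)

/-- A formula of `L(A)`, with the new constants replaced by new variables. -/
def Formula.freeParams : {Δ : List L.Sorts} → Formula (M.paramLanguage A β) x Δ →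
    Formula L (Sum.elim x fun a : Σ s, A s => a.1) Δ
  | _, .loc d t₁ t₂ => .loc (L := L) d t₁.freeParams t₂.freeParams
  | _, .rel R ts => .rel (L := L) R (fun k => (ts k).freeParams)
  | _, .neg φ => .neg φ.freeParams
  | _, .and φ ψ => .and φ.freeParams ψ.freeParams
  | _, .or φ ψ => .or φ.freeParams ψ.freeParams
  | _, .ex s φ => .ex (L := L) s φ.freeParams

/-- The interpretation in an `L(A)`-structure of the new constants. -/
def paramTuple (N : LStructure (M.paramLanguage A β)) :
    (paramReduct N).Tuple (fun a : Σ s, A s => a.1) :=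
  fun a => N.const (.inr a.2)

theorem Term.eval_freeParams (N : LStructure (M.paramLanguage A β)) {Δ : List L.Sorts}
    (v : (paramReduct N).Tuple x) (w : ∀ k : Fin Δ.length, (paramReduct N).carrier (Δ.get k))
    {s : L.Sorts} (t : Term (M.paramLanguage A β) x Δ s) :
    t.freeParams.eval (paramReduct N) ((paramReduct N).join v (paramTuple N)) w = t.eval N v w := by
  rcases t with _ | _ | (_ | _) <;> rfl

theorem Formula.realize_freeParams (N : LStructure (M.paramLanguage A β)) 
    {Δ : List (M.paramLanguage A β).Sorts}
    (v : (paramReduct N).Tuple x) (w : ∀ k : Fin Δ.length, (paramReduct N).carrier (Δ.get k))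
    (φ : Formula (M.paramLanguage A β) x Δ) :
    φ.freeParams.Realize (paramReduct N) ((paramReduct N).join v (paramTuple N)) w ↔
      φ.Realize N v w := by
  induction φ with
  | loc d t₁ t₂ =>
    simp only [freeParams, Realize, Term.eval_freeParams]
    rfl
  | rel R ts =>
    simp only [freeParams, Realize, Term.eval_freeParams]
    rfl
  | neg φ ih => exact not_congr (ih w)
  | and φ ψ ih₁ ih₂ => exact and_congr (ih₁ w) (ih₂ w)
  | or φ ψ ih₁ ih₂ => exact or_congr (ih₁ w) (ih₂ w)
  | ex s φ ih => exact exists_congr fun a => ih ((paramReduct N).push a w)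

theorem Formula.IsPositive.freeParams {Δ : List (M.paramLanguage A β).Sorts}
    {φ : Formula (M.paramLanguage A β) x Δ} (h : φ.IsPositive) : φ.freeParams.IsPositive := by
  induction h with
  | loc d t₁ t₂ => exact .loc _ _ _
  | rel R ts => exact .rel _ _
  | and _ _ ih₁ ih₂ => exact .and ih₁ ih₂
  | or _ _ ih₁ ih₂ => exact .or ih₁ ih₂
  | ex _ ih => exact .ex ih

theorem LStructure.IsLocal.paramExpansion (hM : M.IsLocal) : (M.paramExpansion A β).IsLocal where
  symm := hM.symm
  mono := hM.mono
  comp := hM.comp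
  bound := β.holds
  total := hM.total

/-- The expansion of `N` to `L(A)` along a homomorphism `M → N`. -/
def Hom.expand {N : LStructure L} (f : Hom M N) (β : M.ParamBound A) :
    LStructure (M.paramLanguage A β) where
  carrier := N.carrier
  nonempty := N.nonempty
  const
    | .inl c => N.const c
    | .inr a => f.toFun a
  rel := N.rel
  loc := N.loc
  loc_one := N.loc_one

theorem Hom.isLocal_expand {N : LStructure L} (f : Hom M N) (hN : N.IsLocal) :
    (f.expand β).IsLocal where
  symm := hN.symm
  mono := hN.mono
  comp := hN.comp
  bound {s} c₁ c₂ := by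
    have h : ∀ c : L.Const s ⊕ A s, (f.expand β).const c = f.toFun (M.paramConst A c) := by
      rintro (c | a)
      · exact (f.map_const c).symm
      · rfl
    rw [h, h]
    exact f.map_loc _ _ _ (β.holds c₁ c₂)
  total := hN.total

end Parameters

/-! ### Saturation and retractions -/

section Saturation

/-- The expansion of `N` along a positive embedding `M → N` is a model of `Th₋(M/A)`: a positive
sentence of `L(A)` is a positive formula of `L` about the interpretations of the parameters. -/
theorem Hom.IsPositiveEmbedding.models_expand {M N : LStructure L} {f : Hom M N}
    (hf : f.IsPositiveEmbedding) {A : ∀ s, Set (M.carrier s)} {β : M.ParamBound A}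
    {φ : Sentence (M.paramLanguage A β)} (hφ : φ ∈ M.negTheoryOver A β) :
    (f.expand β).Models φ := by
  obtain ⟨⟨ψ, hψ, rfl⟩, hM⟩ := hφ
  intro h
  -- The reduct of the expansion is `N` itself.
  have hf' : Hom.IsPositiveEmbedding (N := paramReduct (f.expand β)) f := hf
  refine hM ((Formula.realize_freeParams (M.paramExpansion A β) _ _ ψ).1
    (hf' _ _ ψ.freeParams _ hψ.freeParams ?_))
  have h' : (paramReduct (f.expand β)).Sat ψ.freeParams _ :=
    (Formula.realize_freeParams (f.expand β) _ _ ψ).2 h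
  refine (congrArg ((paramReduct (f.expand β)).Sat ψ.freeParams) (funext fun i => ?_)).mp h'
  rcases i with i | i
  · exact i.elim
  · rfl

/-- Every set of parameters of a local structure admits a bound function. -/
theorem LStructure.IsLocal.nonempty_paramBound {M : LStructure L} (hM : M.IsLocal)
    (A : ∀ s, Set (M.carrier s)) : Nonempty (M.ParamBound A) := by
  choose d hd using fun (s : L.Sorts) (a b : M.carrier s) => hM.total a b
  refine ⟨⟨fun {s} c₁ c₂ => match c₁, c₂ with
    | .inl c₁, .inl c₂ => L.bound c₁ c₂
    | c₁, c₂ => d s (M.paramConst A c₁) (M.paramConst A c₂), fun _ _ => rfl, ?_⟩⟩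
  rintro s (c₁ | a₁) (c₂ | a₂)
  · exact hM.bound c₁ c₂
  all_goals exact hd _ _ _

theorem LStructure.IsRetractor.isLocalPosClosed {T : Set (Sentence L)} {R : LStructure L}
    (hR : R.IsRetractor T) : R.IsLocalPosClosed T :=
  ⟨hR.1, fun N hN f => (hR.2 N hN f).elim fun _ h => h.isPositiveEmbedding⟩

/-- Saturation of retractors: the joint property brings the realisation of a type into an
extension of `R`, and the retraction to `R`, which fixes the parameters, brings it into `R`. -/
theorem LStructure.IsRetractor.isAbsolutelySaturated {T : Set (Sentence L)}
    (hT : ∀ φ ∈ T, φ.IsNegative) {R : LStructure L} (hR : R.IsRetractor T) :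
    R.IsAbsolutelySaturated := by
  refine fun κ => ⟨hR.1.1, fun A β _ hJ I x _ p hp => ?_⟩
  obtain ⟨hpos, N, hN, a, ha⟩ := hp.prop
  obtain ⟨P, hP, ⟨f⟩, ⟨g⟩⟩ := hJ (R.paramExpansion A β) N
    (hR.1.1.paramExpansion.isLocalModel_negTheory) hN
  obtain ⟨ρ, hρ⟩ := hR.2 (paramReduct P) (hR.1.paramReduct hT hP) (Hom.reduct f)
  let ρ' : Hom P (R.paramExpansion A β) :=
    { toFun := ρ.toFun
      map_const := fun {s} c => by
        rw [← f.map_const]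
        exact hρ s _
      map_rel := ρ.map_rel
      map_loc := ρ.map_loc }
  exact ⟨_, fun φ hφ => (ρ'.comp g).sat (hpos φ hφ).isPositive a (ha φ hφ)⟩

/-- Given `f : R → N`, a retraction of `f` is a realisation in `R` of the local positive type
over `R` of an enumeration of `N`. Such a type is available since `f` is a positive embedding, and
saturation applies to it since all elements of `R` being named yields the joint property. -/
theorem LStructure.IsAbsolutelySaturated.isRetractor {T : Set (Sentence L)} {R : LStructure L}
    (hR : R.IsAbsolutelySaturated) (hpc : R.IsLocalPosClosed T) : R.IsRetractor T := by
  refine ⟨hpc.1, fun N hN f => ?_⟩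
  let A : ∀ s, Set (R.carrier s) := fun s => Set.univ
  obtain ⟨β⟩ := hpc.1.1.nonempty_paramBound A
  have hc : ∀ s, Nonempty ((R.paramLanguage A β).Const s) := fun s =>
    (R.nonempty s).map fun a => .inr ⟨a, trivial⟩
  have hloc : (R.paramExpansion A β).IsLocal := hpc.1.1.paramExpansion
  have hNR : (f.expand β).IsLocalModel (R.negTheoryOver A β) :=
    ⟨f.isLocal_expand hN.1, fun φ hφ => (hpc.2 N hN f).models_expand hφ⟩
  let x : (Σ s, N.carrier s) → (R.paramLanguage A β).Sorts := Sigma.fst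
  let e : (f.expand β).Tuple x := fun n => n.2
  obtain ⟨p, hp, hpe⟩ := hloc.exists_isLocalPosType hc hNR e
  obtain ⟨a, ha⟩ := (hR (Order.succ (max (Cardinal.mk (Σ s, A s))
    (Cardinal.mk (Σ s, N.carrier s))))).2 A β (Order.lt_succ_of_le (le_max_left _ _))
    (hloc.localJointProperty_negTheory hc) _ x (Order.lt_succ_of_le (le_max_right _ _)) p hp
  replace ha : ∀ φ : Formula (R.paramLanguage A β) x [], φ.IsLocalPositive →
      (f.expand β).Sat φ e → (R.paramExpansion A β).Sat φ a :=
    fun φ h₁ h₂ => ha φ (hpe φ h₁ h₂)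
  let t : ∀ {s : L.Sorts}, N.carrier s → Term (R.paramLanguage A β) x [] s := fun {s} n =>
    .var (x := x) ⟨s, n⟩
  refine ⟨⟨fun {s} n => a ⟨s, n⟩, fun {s} c => ?_, fun {w} S n hn => ?_, fun {s} d n n' hn => ?_⟩,
    fun s r => ?_⟩
  · refine (R.loc_one _ _).1 (ha (.loc (L := R.paramLanguage A β) (1 : L.Loc s) (t (N.const c))
      (.const (L := R.paramLanguage A β) (.inl c))) (.loc _ _ _) ?_)
    exact (N.loc_one _ _).2 rfl
  · exact ha (.rel (L := R.paramLanguage A β) S fun k => t (n k)) (.rel _ _) hn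
  · exact ha (.loc (L := R.paramLanguage A β) d (t n) (t n')) (.loc _ _ _) hn
  · refine (R.loc_one _ _).1 (ha (.loc (L := R.paramLanguage A β) (1 : L.Loc s) (t (f.toFun r))
      (.const (L := R.paramLanguage A β) (.inr ⟨r, trivial⟩))) (.loc _ _ _) ?_)
    exact (N.loc_one _ _).2 rfl

end Saturation

end LocalPositive

theorem mainTheorem1 (L : LocalLanguage.{u}) (T : Set (Sentence L))
    (hT : IsNegativeLocalTheory T) (hsat : LocallySatisfiable T)
    (R : LStructure L) (hR : R.IsLocalModel T) :
    List.TFAE [R.IsAbsolutelyUltrahomogeneous T,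
      R.IsRetractor T,
      R.IsAbsolutelySaturated ∧ R.IsLocalPosClosed T] := by
  tfae_have 1 → 2 := fun h => h.isRetractor
  tfae_have 2 → 1 := fun h => h.isAbsolutelyUltrahomogeneous hT.1
  tfae_have 2 → 3 := fun h => ⟨h.isAbsolutelySaturated hT.1, h.isLocalPosClosed⟩
  tfae_have 3 → 2 := fun h => h.1.isRetractor h.2
  tfae_finish
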